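/- Let $H$ be a real Hilbert space. A set-valued operator $A\colon H\rightrightarrows H$ is monotone if $\langle v_1-v_2,x_1-x_2\rangle\ge 0$ whenever $v_1\in A(x_1)$ and $v_2\in A(x_2)$, and maximally monotone if, in addition, its graph is not properly contained in the graph of another monotone operator. For $v\in A(x)$ and $\tau>0$, let $\Delta_\tau\colon H\rightrightarrows H$ be the difference quotient $\Delta_\tau(h):=\tau^{-1}\bigl(A(x+\tau h)-v\bigr)$. The operator $A$ is proto-differentiable at $x$ relative to $v\in A(x)$ if the graphs of $\Delta_\tau$ converge in the sense of Painlevé–Kuratowski as $\tau\searrow 0$, with respect to the norm topology of $H\times H$, i.e. if their outer limit (the set of all limits of sequences $p_n\in\operatorname{graph}\Delta_{\tau_n}$ with $\tau_n>0$, $\tau_n\to0$) equals their inner limit (the set of all $p$ such that for every sequence $\tau_n>0$, $\tau_n\to 0$, there are $p_n\to p$ with $p_n\in\operatorname{graph}\Delta_{\tau_n}$ for all large $n$). In this case the proto-derivative $D_pA(x\mid v)\colon H\rightrightarrows H$ is the operator whose graph is this limit. **Theorem.** Let $B\colon H\rightrightarrows H$ be maximally monotone. Then its resolvent $J_B:=(\mathrm{Id}+B)^{-1}$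 is a single-valued map defined on all of $H$. Moreover, for every $y\in H$ and $x:=J_B(y)$, the following are equivalent: 1. $B$ is proto-differentiable at $x$ relative to $y-x\in B(x)$, and the proto-derivative $D_pB(x\mid y-x)\colon H\rightrightarrows H$ is maximally monotone; 2. $J_B$ is directionally differentiable at $y$, i.e. the limit $$J_B'(y;h)=\lim_{\tau\searrow0}\frac{J_B(y+\tau h)-J_B(y)}{\tau}$$ exists (in norm) for all $h\in H$. -/

import Mathlib

open Filter Topology

/-! Set-valued operators `H ⇉ H` are functions `H → Set H`; inclusion of graphs is the pointwise
order `≤` on `H → Set H`. -/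

namespace SetValued

variable {H : Type*} [NormedAddCommGroup H] [InnerProductSpace ℝ H]

/-- The graph of a set-valued operator. -/
def graph (A : H → Set H) : Set (H × H) := {p | p.2 ∈ A p.1}

/-- Monotonicity of a set-valued operator on a real inner product space. -/
def IsMonotone (A : H → Set H) : Prop :=
  ∀ x₁ x₂ v₁ v₂ : H, v₁ ∈ A x₁ → v₂ ∈ A x₂ → 0 ≤ inner ℝ (v₁ - v₂) (x₁ - x₂)

/-- Maximal monotonicity: `A` is monotone and its graph is not properly contained in the graph of
another monotone operator. -/
def IsMaximallyMonotone (A : H → Set H) : Prop := Maximal IsMonotone A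

/-- The set-valued inverse of a set-valued operator. -/
def inv (A : H → Set H) : H → Set H := fun y => {x | y ∈ A x}

/-- The operator `Id + A`. -/
def idAdd (A : H → Set H) : H → Set H := fun x => {y | ∃ v ∈ A x, y = x + v}

/-- The value at `y` of the resolvent `J_A = (Id + A)⁻¹` as a point: an element of
`(Id + A)⁻¹ y`, which is arbitrary if that set is empty or has several elements. -/
noncomputable def resolvent (A : H → Set H) (y : H) : H :=
  Classical.epsilon fun x => x ∈ inv (idAdd A) y

/-- The first-order difference quotient `h ↦ (A (x + τ h) - v) / τ` of `A` at `x` relative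
to `v`. -/
def diffQuot (A : H → Set H) (x v : H) (τ : ℝ) : H → Set H :=
  fun h => {k | ∃ w ∈ A (x + τ • h), k = τ⁻¹ • (w - v)}

/-- The (Painlevé-Kuratowski) outer limit of a family of sets `S τ` as `τ ↘ 0`, in the given
topology (the norm topology when `X` is normed). -/
def outerLimit {X : Type*} [TopologicalSpace X] (S : ℝ → Set X) : Set X :=
  {p | ∃ (τ : ℕ → ℝ) (u : ℕ → X), (∀ n, 0 < τ n) ∧ Tendsto τ atTop (𝓝 0) ∧
    (∀ n, u n ∈ S (τ n)) ∧ Tendsto u atTop (𝓝 p)}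

/-- The (Painlevé-Kuratowski) inner limit of a family of sets `S τ` as `τ ↘ 0`. -/
def innerLimit {X : Type*} [TopologicalSpace X] (S : ℝ → Set X) : Set X :=
  {p | ∀ τ : ℕ → ℝ, (∀ n, 0 < τ n) → Tendsto τ atTop (𝓝 0) →
    ∃ u : ℕ → X, (∀ᶠ n in atTop, u n ∈ S (τ n)) ∧ Tendsto u atTop (𝓝 p)}

/-- `A` is proto-differentiable at `x` relative to `v ∈ A x`: the graphs of the difference
quotients converge, i.e. their outer and inner limits as `τ ↘ 0` coincide. -/
def IsProtoDifferentiableAt (A : H → Set H) (x v : H) : Prop :=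
  v ∈ A x ∧
    outerLimit (fun τ => graph (diffQuot A x v τ)) = innerLimit (fun τ => graph (diffQuot A x v τ))

/-- The proto-derivative of `A` at `x` relative to `v`: the operator whose graph is the limit of
the graphs of the difference quotients (the outer limit, which is the limit as soon as `A` is
proto-differentiable at `x` relative to `v`). -/
def protoDeriv (A : H → Set H) (x v : H) : H → Set H :=
  fun h => {k | (h, k) ∈ outerLimit (fun τ => graph (diffQuot A x v τ))}

/-- `f` is directionally differentiable at `y`: the limit of `(f (y + τ h) - f y) / τ` as `τ ↘ 0`
exists in norm for every direction `h`. -/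
def IsDirectionallyDifferentiableAt (f : H → H) (y : H) : Prop :=
  ∀ h : H, ∃ d : H, Tendsto (fun τ : ℝ => τ⁻¹ • (f (y + τ • h) - f y)) (𝓝[>] 0) (𝓝 d)

end SetValued

namespace SetValued

/-! The linear homeomorphism `(h, k) ↦ (h + k, h)` carries the graph of the difference quotient of
`B` onto that of `J_B` (`mem_graph_diffQuot`). The latter quotients are 1-Lipschitz, so a limit of
their graphs having a point over every `h` amounts to pointwise convergence. Such points exist when
`Id + D_pB` is surjective, which Minty's theorem derives from maximality. Conversely, a pointwise
limit `G` is firmly nonexpansive and everywhere defined, hence the resolvent of a maximally monotone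
operator, namely `D_pB`.

Minty's theorem comes from minimising the Fitzpatrick function plus half the squared norm. -/

/-- A closed convex subset `C` of `E × ℝ`, read as an epigraph, on which `r + ‖p‖² / 2` is bounded
below contains a minimiser of that functional, characterised by its variational inequality. -/
theorem exists_variational_inequality {E : Type*} [NormedAddCommGroup E] [InnerProductSpace ℝ E]
    [CompleteSpace E] {C : Set (E × ℝ)} (hne : C.Nonempty) (hconv : Convex ℝ C) (hcl : IsClosed C)
    (hbd : ∀ p ∈ C, 0 ≤ p.2 + ‖p.1‖ ^ 2 / 2) :
    ∃ p ∈ C, ∀ q ∈ C, 0 ≤ inner ℝ p.1 (q.1 - p.1) + (q.2 - p.2) := by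
  set f : E × ℝ → ℝ := fun p => p.2 + ‖p.1‖ ^ 2 / 2 with hf
  have hbdd : BddBelow (f '' C) := ⟨0, by rintro _ ⟨p, hp, rfl⟩; exact hbd p hp⟩
  set m := sInf (f '' C) with hm
  have hmle : ∀ p ∈ C, m ≤ f p := fun p hp => csInf_le hbdd ⟨p, hp, rfl⟩
  have hex : ∀ n : ℕ, ∃ p ∈ C, f p < m + 1 / ((n : ℝ) + 1) := by
    intro n
    obtain ⟨_, ⟨p, hp, rfl⟩, hlt⟩ := exists_lt_of_csInf_lt (hne.image f)
      (lt_add_of_pos_right m (Nat.one_div_pos_of_nat (n := n) (α := ℝ)))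
    exact ⟨p, hp, hlt⟩
  choose u huC hu using hex
  have hfu : Tendsto (fun n => f (u n)) atTop (𝓝 m) := by
    refine tendsto_of_tendsto_of_tendsto_of_le_of_le tendsto_const_nhds ?_
      (fun n => hmle _ (huC n)) (fun n => (hu n).le)
    simpa using tendsto_const_nhds.add (tendsto_one_div_add_atTop_nhds_zero_nat (𝕜 := ℝ))
  -- Parallelogram identity, with `m` bounding `f` from below at the midpoint: minimising sequences
  -- are Cauchy in `E`.
  have hpar : ∀ p ∈ C, ∀ q ∈ C, ‖p.1 - q.1‖ ^ 2 ≤ 4 * (f p - m) + 4 * (f q - m) := by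
    intro p hp q hq
    have h1 := hmle _ (hconv hp hq (a := 1 / 2) (b := 1 / 2) (by norm_num) (by norm_num)
      (by norm_num))
    have h2 : ‖(1 / 2 : ℝ) • p.1 + (1 / 2 : ℝ) • q.1‖ ^ 2 =
        (‖p.1‖ ^ 2 + ‖q.1‖ ^ 2) / 2 - ‖p.1 - q.1‖ ^ 2 / 4 := by
      rw [norm_add_sq_real, norm_sub_sq_real, norm_smul, norm_smul, real_inner_smul_left,
        real_inner_smul_right, Real.norm_of_nonneg (by norm_num : (0 : ℝ) ≤ 1 / 2)]
      ring
    simp only [hf, Prod.fst_add, Prod.smul_fst, Prod.snd_add, Prod.smul_snd, smul_eq_mul] at h1 ⊢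
    rw [h2] at h1
    linarith
  have hcau : CauchySeq fun n => (u n).1 := by
    refine cauchySeq_of_le_tendsto_0 (fun N : ℕ => √(8 * (1 / ((N : ℝ) + 1)))) ?_ ?_
    · intro n k N hn hk
      rw [dist_eq_norm]
      refine Real.le_sqrt_of_sq_le ((hpar _ (huC n) _ (huC k)).trans ?_)
      have := Nat.one_div_le_one_div (α := ℝ) hn
      have := Nat.one_div_le_one_div (α := ℝ) hk
      linarith [hu n, hu k]
    · simpa using (((tendsto_one_div_add_atTop_nhds_zero_nat (𝕜 := ℝ)).const_mul 8).sqrt)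
  obtain ⟨p, hp⟩ := cauchySeq_tendsto_of_complete hcau
  have hr : Tendsto (fun n => (u n).2) atTop (𝓝 (m - ‖p‖ ^ 2 / 2)) := by
    simpa [hf] using hfu.sub ((hp.norm.pow 2).div_const 2)
  have hpC : (p, m - ‖p‖ ^ 2 / 2) ∈ C :=
    hcl.mem_of_tendsto (hp.prodMk_nhds hr) (Eventually.of_forall huC)
  refine ⟨_, hpC, fun q hq => ?_⟩
  -- Compare `f` at the minimiser and at a point of the segment towards `q`, then divide by `t`.
  have key : ∀ t ∈ Set.Ioc (0 : ℝ) 1, 0 ≤ inner ℝ p (q.1 - p) + (q.2 - (m - ‖p‖ ^ 2 / 2))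
      + t * (‖q.1 - p‖ ^ 2 / 2) := by
    rintro t ⟨ht0, ht1⟩
    have h1 := hmle _ (hconv.add_smul_sub_mem hpC hq ⟨ht0.le, ht1⟩)
    simp only [hf, Prod.fst_add, Prod.smul_fst, Prod.snd_add, Prod.smul_snd, smul_eq_mul,
      Prod.fst_sub, Prod.snd_sub] at h1
    rw [norm_add_sq_real, norm_smul, real_inner_smul_right, Real.norm_of_nonneg ht0.le] at h1
    refine nonneg_of_mul_nonneg_right (b := _) (a := t) ?_ ht0
    linarith
  have hlim : Tendsto (fun t : ℝ => inner ℝ p (q.1 - p) + (q.2 - (m - ‖p‖ ^ 2 / 2))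
      + t * (‖q.1 - p‖ ^ 2 / 2)) (𝓝[>] 0)
      (𝓝 (inner ℝ p (q.1 - p) + (q.2 - (m - ‖p‖ ^ 2 / 2)) + 0 * (‖q.1 - p‖ ^ 2 / 2))) :=
    (Continuous.tendsto (by fun_prop) 0).mono_left nhdsWithin_le_nhds
  simpa using ge_of_tendsto hlim
    (by filter_upwards [Ioc_mem_nhdsGT zero_lt_one] with t ht using key t ht)

theorem mem_inv_idAdd {H : Type*} [NormedAddCommGroup H] {A : H → Set H} {x z : H} :
    x ∈ inv (idAdd A) z ↔ z - x ∈ A x := by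
  constructor
  · rintro ⟨v, hv, rfl⟩
    simpa using hv
  · exact fun h => ⟨_, h, by simp⟩

/-! ### Fitzpatrick function and Minty's theorem -/

variable {H : Type*} [NormedAddCommGroup H] [InnerProductSpace ℝ H] {A B : H → Set H}

theorem IsMaximallyMonotone.mem_of_forall_nonneg (hA : IsMaximallyMonotone A) {x v : H}
    (h : ∀ a b, b ∈ A a → 0 ≤ inner ℝ (b - v) (a - x)) : v ∈ A x := by
  have hmono : IsMonotone fun a => A a ∪ {b | a = x ∧ b = v} := by
    rintro a₁ a₂ b₁ b₂ (h₁ | ⟨rfl, rfl⟩) (h₂ | ⟨rfl, rfl⟩)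
    · exact hA.1 _ _ _ _ h₁ h₂
    · exact h _ _ h₁
    · rw [← neg_sub b₂, ← neg_sub a₂, inner_neg_neg]
      exact h _ _ h₂
    · simp
  exact hA.2 hmono (fun a b hb => Or.inl hb) x (Or.inr ⟨rfl, rfl⟩)

theorem IsMaximallyMonotone.exists_mem (hA : IsMaximallyMonotone A) : ∃ a b, b ∈ A a := by
  by_contra! h
  exact h 0 0 (hA.mem_of_forall_nonneg fun a b hb => absurd hb (h a b))

/-- The epigraph of the Fitzpatrick function `(x, u) ↦ sup {⟪x, b⟫ + ⟪a, u⟫ - ⟪a, b⟫ | b ∈ A a}`. -/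
def fitzpatrickEpigraph (A : H → Set H) : Set (WithLp 2 (H × H) × ℝ) :=
  {p | ∀ a b, b ∈ A a → inner ℝ p.1.fst b + inner ℝ a p.1.snd - inner ℝ a b ≤ p.2}

theorem convex_fitzpatrickEpigraph : Convex ℝ (fitzpatrickEpigraph A) := by
  intro p hp q hq s t hs ht hst a b hb
  have h1 := mul_le_mul_of_nonneg_left (hp a b hb) hs
  have h2 := mul_le_mul_of_nonneg_left (hq a b hb) ht
  simp only [Prod.fst_add, Prod.smul_fst, Prod.snd_add, Prod.smul_snd, WithLp.add_fst,
    WithLp.add_snd, WithLp.smul_fst, WithLp.smul_snd, inner_add_left, inner_add_right,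
    real_inner_smul_left, real_inner_smul_right, smul_eq_mul]
  have h3 : inner ℝ a b = s * inner ℝ a b + t * inner ℝ a b := by rw [← add_mul, hst, one_mul]
  linarith

theorem isClosed_fitzpatrickEpigraph : IsClosed (fitzpatrickEpigraph A) := by
  simp only [fitzpatrickEpigraph, Set.ofPred_forall]
  refine isClosed_iInter fun a => isClosed_iInter fun b => isClosed_iInter fun _ =>
    isClosed_le ?_ continuous_snd
  have h1 : Continuous fun p : WithLp 2 (H × H) × ℝ => p.1.fst :=
    (WithLp.continuous_fst ..).comp continuous_fst
  have h2 : Continuous fun p : WithLp 2 (H × H) × ℝ => p.1.snd :=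
    (WithLp.continuous_snd ..).comp continuous_fst
  fun_prop

theorem IsMonotone.mem_fitzpatrickEpigraph (hA : IsMonotone A) {a b : H} (hb : b ∈ A a) :
    (WithLp.toLp 2 (a, b), inner ℝ a b) ∈ fitzpatrickEpigraph A := by
  intro a' b' hb'
  have := hA _ _ _ _ hb hb'
  simp only [inner_sub_left, inner_sub_right] at this
  simp only [WithLp.toLp_fst, WithLp.toLp_snd]
  rw [real_inner_comm b' a, real_inner_comm b a', real_inner_comm b' a', real_inner_comm b a]
  linarith

/-- Were the inequality to fail, the point would be monotonically related to the graph, hence in it;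
testing the epigraph condition there is a contradiction. -/
theorem IsMaximallyMonotone.inner_le_of_mem_fitzpatrickEpigraph (hA : IsMaximallyMonotone A)
    {p : WithLp 2 (H × H) × ℝ} (hp : p ∈ fitzpatrickEpigraph A) :
    inner ℝ p.1.fst p.1.snd ≤ p.2 := by
  by_contra! hlt
  have hmem : p.1.snd ∈ A p.1.fst := by
    refine hA.mem_of_forall_nonneg fun a b hb => ?_
    have := hp a b hb
    simp only [inner_sub_left, inner_sub_right]
    rw [real_inner_comm p.1.fst b, real_inner_comm a p.1.snd, real_inner_comm p.1.fst p.1.snd,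
      real_inner_comm a b]
    linarith
  have := hp _ _ hmem
  linarith

/-- Minty's theorem at the origin. -/
theorem IsMaximallyMonotone.exists_neg_mem [CompleteSpace H] (hA : IsMaximallyMonotone A) :
    ∃ x, -x ∈ A x := by
  obtain ⟨a, b, hab⟩ := hA.exists_mem
  obtain ⟨⟨p, r⟩, hp, hvar⟩ := exists_variational_inequality
    ⟨_, hA.1.mem_fitzpatrickEpigraph hab⟩ convex_fitzpatrickEpigraph isClosed_fitzpatrickEpigraph
    (fun p hp => by
      have h1 := hA.inner_le_of_mem_fitzpatrickEpigraph hp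
      have h2 := norm_add_sq_real p.1.fst p.1.snd
      rw [WithLp.prod_norm_sq_eq_of_L2]
      nlinarith [sq_nonneg ‖p.1.fst + p.1.snd‖])
  have hle : inner ℝ p.fst p.snd ≤ r := hA.inner_le_of_mem_fitzpatrickEpigraph hp
  -- The variational inequality at graph points, with `hle` used to complete the square.
  have hvar' : ∀ a b, b ∈ A a → ‖p.fst + p.snd‖ ^ 2 ≤ inner ℝ (b - -p.fst) (a - -p.snd) := by
    intro a b hb
    have h := hvar _ (hA.1.mem_fitzpatrickEpigraph hb)
    simp only [inner_sub_right, real_inner_self_eq_norm_sq] at h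
    rw [WithLp.prod_norm_sq_eq_of_L2] at h
    change 0 ≤ inner ℝ p.fst a + inner ℝ p.snd b - (‖p.fst‖ ^ 2 + ‖p.snd‖ ^ 2)
      + (inner ℝ a b - r) at h
    rw [norm_add_sq_real, sub_neg_eq_add, sub_neg_eq_add, inner_add_left, inner_add_right,
      inner_add_right, real_inner_comm a b, real_inner_comm p.snd b]
    linarith
  have hmem : -p.fst ∈ A (-p.snd) :=
    hA.mem_of_forall_nonneg fun a b hb => (sq_nonneg _).trans (hvar' a b hb)
  -- At the graph point `(-p.snd, -p.fst)` itself the right side of `hvar'` is zero.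
  have hzero : p.fst + p.snd = 0 := by
    have := hvar' _ _ hmem
    simpa using this
  have hsnd : p.snd = -p.fst := (neg_eq_of_add_eq_zero_right hzero).symm
  exact ⟨p.fst, by simpa [hsnd] using hmem⟩

theorem IsMaximallyMonotone.translate (hA : IsMaximallyMonotone A) (z : H) :
    IsMaximallyMonotone fun x => {v | v + z ∈ A x} := by
  refine ⟨fun x₁ x₂ v₁ v₂ h₁ h₂ => ?_, fun C hC hle x v hv => ?_⟩
  · simpa using hA.1 _ _ _ _ h₁ h₂
  · refine hA.mem_of_forall_nonneg fun a b hb => ?_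
    have := hC a x (b - z) v (hle a (by simpa using hb)) hv
    rwa [sub_sub, add_comm z] at this

/-- **Minty's theorem**: `Id + A` is surjective for a maximally monotone operator `A` on a Hilbert
space. -/
theorem IsMaximallyMonotone.exists_sub_mem [CompleteSpace H] (hA : IsMaximallyMonotone A) (z : H) :
    ∃ x, z - x ∈ A x := by
  obtain ⟨x, hx⟩ := (hA.translate z).exists_neg_mem
  exact ⟨x, by simpa [sub_eq_neg_add] using hx⟩

theorem IsMonotone.eq_of_sub_mem (hA : IsMonotone A) {z x₁ x₂ : H} (h₁ : z - x₁ ∈ A x₁)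
    (h₂ : z - x₂ ∈ A x₂) : x₁ = x₂ := by
  have h := hA _ _ _ _ h₁ h₂
  rw [sub_sub_sub_cancel_left, ← neg_sub x₁ x₂, inner_neg_left, real_inner_self_eq_norm_sq] at h
  rw [← sub_eq_zero, ← norm_eq_zero]
  nlinarith [sq_nonneg ‖x₁ - x₂‖]

/-- A monotone operator `A` for which `Id + A` is surjective is maximally monotone. -/
theorem IsMonotone.isMaximallyMonotone (hA : IsMonotone A) (h : ∀ z, ∃ x, z - x ∈ A x) :
    IsMaximallyMonotone A := by
  refine ⟨hA, fun C hC hle x v hv => ?_⟩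
  obtain ⟨x', hx'⟩ := h (x + v)
  have : x' = x := hC.eq_of_sub_mem (hle _ hx') (by simpa using hv)
  simpa [this] using hx'

/-! ### Resolvents and their difference quotients -/

section Resolvent

variable [CompleteSpace H]

theorem IsMaximallyMonotone.sub_resolvent_mem (hB : IsMaximallyMonotone B) (z : H) :
    z - resolvent B z ∈ B (resolvent B z) := by
  obtain ⟨x, hx⟩ := hB.exists_sub_mem z
  exact mem_inv_idAdd.1 (Classical.epsilon_spec (p := fun x => x ∈ inv (idAdd B) z)
    ⟨x, mem_inv_idAdd.2 hx⟩)

theorem IsMaximallyMonotone.mem_iff_resolvent_eq (hB : IsMaximallyMonotone B) {x v : H} :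
    v ∈ B x ↔ resolvent B (x + v) = x := by
  have h := hB.sub_resolvent_mem (x + v)
  constructor
  · exact fun hv => hB.1.eq_of_sub_mem h (by simpa using hv)
  · intro hx
    simpa [hx] using h

theorem IsMaximallyMonotone.inv_idAdd_eq (hB : IsMaximallyMonotone B) (z : H) :
    inv (idAdd B) z = {resolvent B z} := by
  ext x
  rw [mem_inv_idAdd, hB.mem_iff_resolvent_eq, add_sub_cancel, Set.mem_singleton_iff, eq_comm]

theorem IsMaximallyMonotone.resolvent_firmly_nonexpansive (hB : IsMaximallyMonotone B) (z w : H) :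
    ‖resolvent B z - resolvent B w‖ ^ 2 ≤ inner ℝ (z - w) (resolvent B z - resolvent B w) := by
  have h := hB.1 _ _ _ _ (hB.sub_resolvent_mem z) (hB.sub_resolvent_mem w)
  rw [sub_sub_sub_comm, inner_sub_left, real_inner_self_eq_norm_sq] at h
  linarith

/-- The difference quotient of the resolvent of `B` at `y`. -/
noncomputable def resolventQuot (B : H → Set H) (y : H) (τ : ℝ) (h : H) : H :=
  τ⁻¹ • (resolvent B (y + τ • h) - resolvent B y)

theorem IsMaximallyMonotone.resolventQuot_firmly_nonexpansive (hB : IsMaximallyMonotone B) (y : H)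
    {τ : ℝ} (hτ : 0 < τ) (h k : H) :
    ‖resolventQuot B y τ h - resolventQuot B y τ k‖ ^ 2 ≤
      inner ℝ (h - k) (resolventQuot B y τ h - resolventQuot B y τ k) := by
  have key := hB.resolvent_firmly_nonexpansive (y + τ • h) (y + τ • k)
  rw [add_sub_add_left_eq_sub, ← smul_sub, real_inner_smul_left] at key
  rw [resolventQuot, resolventQuot, ← smul_sub, sub_sub_sub_cancel_right, norm_smul,
    real_inner_smul_right, Real.norm_of_nonneg (inv_pos.2 hτ).le, mul_pow]
  calc _ ≤ τ⁻¹ ^ 2 * (τ * inner ℝ (h - k)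
        (resolvent B (y + τ • h) - resolvent B (y + τ • k))) := by gcongr
    _ = _ := by field_simp

theorem IsMaximallyMonotone.norm_resolventQuot_sub_le (hB : IsMaximallyMonotone B) (y : H)
    {τ : ℝ} (hτ : 0 < τ) (h k : H) :
    ‖resolventQuot B y τ h - resolventQuot B y τ k‖ ≤ ‖h - k‖ := by
  have h1 := hB.resolventQuot_firmly_nonexpansive y hτ h k
  have h2 := real_inner_le_norm (h - k) (resolventQuot B y τ h - resolventQuot B y τ k)
  by_contra! hlt
  nlinarith [norm_nonneg (h - k)]

theorem IsMaximallyMonotone.mem_graph_diffQuot (hB : IsMaximallyMonotone B) (y : H) {τ : ℝ}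
    (hτ : 0 < τ) {p : H × H} :
    p ∈ graph (diffQuot B (resolvent B y) (y - resolvent B y) τ) ↔
      resolventQuot B y τ (p.1 + p.2) = p.1 := by
  have h1 : p ∈ graph (diffQuot B (resolvent B y) (y - resolvent B y) τ) ↔
      (y - resolvent B y) + τ • p.2 ∈ B (resolvent B y + τ • p.1) := by
    constructor
    · rintro ⟨w, hw, hk⟩
      rwa [hk, smul_inv_smul₀ hτ.ne', add_sub_cancel]
    · exact fun h => ⟨_, h, by rw [add_sub_cancel_left, inv_smul_smul₀ hτ.ne']⟩
  have h2 : resolvent B y + τ • p.1 + (y - resolvent B y + τ • p.2) = y + τ • (p.1 + p.2) := by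
    rw [smul_add]; abel
  rw [h1, hB.mem_iff_resolvent_eq, h2, resolventQuot, inv_smul_eq_iff₀ hτ.ne', sub_eq_iff_eq_add']

end Resolvent

/-! ### Graph limits versus directional limits -/

theorem innerLimit_subset_outerLimit {X : Type*} [TopologicalSpace X] (S : ℝ → Set X) :
    innerLimit S ⊆ outerLimit S := by
  intro p hp
  obtain ⟨u, hu, hlim⟩ := hp (fun n : ℕ => 1 / ((n : ℝ) + 1)) (fun n => Nat.one_div_pos_of_nat)
    tendsto_one_div_add_atTop_nhds_zero_nat
  -- The outer limit requires membership for every index, so the sequences are shifted by `N`.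
  obtain ⟨N, hN⟩ := eventually_atTop.1 hu
  exact ⟨fun n => 1 / (((n + N : ℕ) : ℝ) + 1), fun n => u (n + N),
    fun n => Nat.one_div_pos_of_nat,
    (tendsto_add_atTop_iff_nat N).2 (tendsto_one_div_add_atTop_nhds_zero_nat (𝕜 := ℝ)),
    fun n => hN _ (Nat.le_add_left ..), (tendsto_add_atTop_iff_nat N).2 hlim⟩

theorem tendsto_nhdsGT_of_forall_pos {X : Type*} [TopologicalSpace X] {f : ℝ → X} {l : X}
    (h : ∀ τ : ℕ → ℝ, (∀ n, 0 < τ n) → Tendsto τ atTop (𝓝 0) →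
      Tendsto (fun n => f (τ n)) atTop (𝓝 l)) :
    Tendsto f (𝓝[>] 0) (𝓝 l) := by
  refine tendsto_of_seq_tendsto fun τ hτ => ?_
  rw [tendsto_nhdsWithin_iff] at hτ
  obtain ⟨N, hN⟩ := eventually_atTop.1 hτ.2
  exact (tendsto_add_atTop_iff_nat N).1 (h (fun n => τ (n + N))
    (fun n => hN _ (Nat.le_add_left ..)) ((tendsto_add_atTop_iff_nat N).2 hτ.1))

section Differentiability

variable [CompleteSpace H]

theorem IsMaximallyMonotone.tendsto_resolventQuot_of_tendsto (hB : IsMaximallyMonotone B) (y : H)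
    {τ : ℕ → ℝ} (hτ : ∀ n, 0 < τ n) {u : ℕ → H} {h l : H} (hu : Tendsto u atTop (𝓝 h)) :
    Tendsto (fun n => resolventQuot B y (τ n) (u n)) atTop (𝓝 l) ↔
      Tendsto (fun n => resolventQuot B y (τ n) h) atTop (𝓝 l) := by
  have hdiff : Tendsto (fun n => resolventQuot B y (τ n) (u n) - resolventQuot B y (τ n) h)
      atTop (𝓝 0) :=
    squeeze_zero_norm (fun n => hB.norm_resolventQuot_sub_le y (hτ n) _ _)
      (by simpa using (hu.sub_const h).norm)
  constructor
  · intro hl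
    simpa using hl.sub hdiff
  · intro hl
    simpa using hl.add hdiff

theorem IsMaximallyMonotone.isDirectionallyDifferentiableAt_resolvent
    (hB : IsMaximallyMonotone B) {y : H}
    (hP : IsProtoDifferentiableAt B (resolvent B y) (y - resolvent B y))
    (hD : IsMaximallyMonotone (protoDeriv B (resolvent B y) (y - resolvent B y))) :
    IsDirectionallyDifferentiableAt (resolvent B) y := by
  intro h
  -- Minty's theorem for the proto-derivative supplies the candidate for `J_B'(y; h)`.
  obtain ⟨d, hd⟩ := hD.exists_sub_mem h
  refine ⟨d, tendsto_nhdsGT_of_forall_pos fun τ hτ hτ0 => ?_⟩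
  -- Membership in the inner limit gives approximating graph points along every `τ`.
  have hin := hP.2.subset hd
  obtain ⟨u, hu, hlim⟩ := hin τ hτ hτ0
  have h1 : Tendsto (fun n => (u n).1) atTop (𝓝 d) := (continuous_fst.tendsto _).comp hlim
  have h2 : Tendsto (fun n => (u n).2) atTop (𝓝 (h - d)) := (continuous_snd.tendsto _).comp hlim
  have h3 : Tendsto (fun n => (u n).1 + (u n).2) atTop (𝓝 h) := by simpa using h1.add h2
  refine (hB.tendsto_resolventQuot_of_tendsto y hτ h3).1 (h1.congr' ?_)
  filter_upwards [hu] with n hn using ((hB.mem_graph_diffQuot y (hτ n)).1 hn).symm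

theorem IsMaximallyMonotone.mem_outerLimit_diffQuot (hB : IsMaximallyMonotone B) {y : H}
    {G : H → H} (hG : ∀ h, Tendsto (fun τ => resolventQuot B y τ h) (𝓝[>] 0) (𝓝 (G h)))
    {p : H × H} (hp : p ∈ outerLimit fun τ =>
      graph (diffQuot B (resolvent B y) (y - resolvent B y) τ)) :
    G (p.1 + p.2) = p.1 := by
  obtain ⟨τ, u, hτ, hτ0, hu, hlim⟩ := hp
  have h1 : Tendsto (fun n => (u n).1) atTop (𝓝 p.1) := (continuous_fst.tendsto _).comp hlim
  have h2 : Tendsto (fun n => (u n).2) atTop (𝓝 p.2) := (continuous_snd.tendsto _).comp hlim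
  have hτ' : Tendsto τ atTop (𝓝[>] 0) :=
    tendsto_nhdsWithin_iff.2 ⟨hτ0, Eventually.of_forall hτ⟩
  refine tendsto_nhds_unique ((hG _).comp hτ')
    ((hB.tendsto_resolventQuot_of_tendsto y hτ (h1.add h2)).1 (h1.congr fun n => ?_))
  exact ((hB.mem_graph_diffQuot y (hτ n)).1 (hu n)).symm

theorem IsMaximallyMonotone.mem_innerLimit_diffQuot (hB : IsMaximallyMonotone B) {y : H}
    {G : H → H} (hG : ∀ h, Tendsto (fun τ => resolventQuot B y τ h) (𝓝[>] 0) (𝓝 (G h)))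
    {p : H × H} (hp : G (p.1 + p.2) = p.1) :
    p ∈ innerLimit fun τ => graph (diffQuot B (resolvent B y) (y - resolvent B y) τ) := by
  intro τ hτ hτ0
  have hτ' : Tendsto τ atTop (𝓝[>] 0) :=
    tendsto_nhdsWithin_iff.2 ⟨hτ0, Eventually.of_forall hτ⟩
  have h1 : Tendsto (fun n => resolventQuot B y (τ n) (p.1 + p.2)) atTop (𝓝 p.1) := by
    have := (hG (p.1 + p.2)).comp hτ'
    rwa [hp] at this
  refine ⟨fun n => (resolventQuot B y (τ n) (p.1 + p.2),
    p.1 + p.2 - resolventQuot B y (τ n) (p.1 + p.2)), Eventually.of_forall fun n => ?_, ?_⟩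
  · rw [hB.mem_graph_diffQuot y (hτ n), add_sub_cancel]
  · exact h1.prodMk_nhds (by simpa using h1.const_sub (p.1 + p.2))

theorem IsMaximallyMonotone.isProtoDifferentiableAt (hB : IsMaximallyMonotone B) {y : H}
    (hJ : IsDirectionallyDifferentiableAt (resolvent B) y) :
    IsProtoDifferentiableAt B (resolvent B y) (y - resolvent B y) ∧
      IsMaximallyMonotone (protoDeriv B (resolvent B y) (y - resolvent B y)) := by
  choose G hG using hJ
  change ∀ h, Tendsto (fun τ => resolventQuot B y τ h) (𝓝[>] 0) (𝓝 (G h)) at hG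
  have hmem : ∀ {h k : H},
      k ∈ protoDeriv B (resolvent B y) (y - resolvent B y) h ↔ G (h + k) = h :=
    ⟨fun hk => hB.mem_outerLimit_diffQuot hG hk,
      fun hk => innerLimit_subset_outerLimit _ (hB.mem_innerLimit_diffQuot hG (p := (_, _)) hk)⟩
  -- Firm nonexpansiveness survives the limit; at sums `x + v` it becomes monotonicity of the
  -- proto-derivative.
  have hfirm : ∀ h k, ‖G h - G k‖ ^ 2 ≤ inner ℝ (h - k) (G h - G k) := by
    intro h k
    refine le_of_tendsto_of_tendsto (((hG h).sub (hG k)).norm.pow 2)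
      (tendsto_const_nhds.inner ((hG h).sub (hG k))) ?_
    filter_upwards [self_mem_nhdsWithin] with τ hτ
    exact hB.resolventQuot_firmly_nonexpansive y hτ h k
  refine ⟨⟨hB.sub_resolvent_mem y, Set.Subset.antisymm (fun p hp => ?_)
    (innerLimit_subset_outerLimit _)⟩, IsMonotone.isMaximallyMonotone ?_ fun z => ?_⟩
  · exact hB.mem_innerLimit_diffQuot hG (hB.mem_outerLimit_diffQuot hG hp)
  · intro x₁ x₂ v₁ v₂ h₁ h₂
    have h := hfirm (x₁ + v₁) (x₂ + v₂)
    rw [hmem.1 h₁, hmem.1 h₂, add_sub_add_comm, inner_add_left, real_inner_self_eq_norm_sq] at h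
    linarith
  · exact ⟨G z, hmem.2 (by rw [add_sub_cancel])⟩

end Differentiability

end SetValued

theorem theorem3p1 {H : Type*} [NormedAddCommGroup H] [InnerProductSpace ℝ H] [CompleteSpace H]
    (B : H → Set H) (hB : SetValued.IsMaximallyMonotone B) :
    (∀ z : H, SetValued.inv (SetValued.idAdd B) z = {SetValued.resolvent B z}) ∧
    ∀ x y : H, x = SetValued.resolvent B y →
      ((SetValued.IsProtoDifferentiableAt B x (y - x) ∧
          SetValued.IsMaximallyMonotone (SetValued.protoDeriv B x (y - x))) ↔
        SetValued.IsDirectionallyDifferentiableAt (SetValued.resolvent B) y) := by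
  refine ⟨hB.inv_idAdd_eq, ?_⟩
  rintro _ y rfl
  exact ⟨fun h => hB.isDirectionallyDifferentiableAt_resolvent h.1 h.2, hB.isProtoDifferentiableAt⟩
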